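/- Let $b\ge 1$ be an integer, $A=\{0,\dots,b-1\}$ and $\widehat A=\{0,\dots,b\}=A\cup\{b\}$. For a finite alphabet $\Sigma$, an infinite word $u=u_1u_2u_3\cdots\in\Sigma^\omega$ is called normal to $\Sigma$ if for every integer $\ell\ge 1$ and every word $x\in\Sigma^\ell$, $$\lim_{n\to\infty}\frac{1}{n}\,\#\{0\le k<n : u_{\ell k+1}u_{\ell k+2}\cdots u_{\ell k+\ell}=x\}=\frac{1}{|\Sigma|^{\ell}}.$$ For $w\in\widehat A^\omega$ having infinitely many symbols different from $b$, let $r(w)\in A^\omega$ be the infinite word obtained from $w$ by deleting every occurrence of the symbol $b$. Theorem. For every $v\in A^\omega$ that is normal to $A$ there is a word $\widehat v\in\widehat A^\omega$ that is normal to $\widehat A$, in which the symbol $b$ and also symbols different from $b$ occur infinitely often, such that $r(\widehat v)=v$. -/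

import Mathlib

open Filter Topology

/-- The number of aligned occurrences of the finite word `v` in the finite word `u`: the number of
positions `i` (counted from `0`) with `i + |v| ≤ |u|` that are multiples of `|v|` and at which the
substring of `u` of length `|v|` is `v`. -/
def alignedOcc {α : Type*} [DecidableEq α] (u v : List α) : ℕ :=
  ((Finset.range (u.length + 1 - v.length)).filter
    (fun i => v.length ∣ i ∧ (u.drop i).take v.length = v)).card

/-- The word consisting of the first `n` symbols of the infinite word `u`. -/
def wordPrefix {α : Type*} (u : ℕ → α) (n : ℕ) : List α :=
  (List.range n).map u

/-- Simple normality of `u` to length `ℓ`, for the alphabet `α`. -/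
def IsSimplyNormal {α : Type*} [Fintype α] [DecidableEq α] (u : ℕ → α) (ℓ : ℕ) : Prop :=
  ∀ v : List α, v.length = ℓ →
    Tendsto (fun n : ℕ => (alignedOcc (wordPrefix u (ℓ * n)) v : ℝ) / (n : ℝ)) atTop
      (𝓝 (1 / (Fintype.card α : ℝ) ^ ℓ))

/-- Normality of the infinite word `u` to the alphabet `α`: simple normality to every positive
length. -/
def IsNormalWord {α : Type*} [Fintype α] [DecidableEq α] (u : ℕ → α) : Prop :=
  ∀ ℓ : ℕ, 1 ≤ ℓ → IsSimplyNormal u ℓ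

/-- The reduction `r(w)` of an infinite word `w` over `{0, …, b}`: its `i`-th symbol is the `i`-th
symbol of `w` different from `b`. It is an infinite word over `{0, …, b - 1}` exactly when
infinitely many symbols of `w` differ from `b`, which is the hypothesis `hw`. -/
noncomputable def reduction {b : ℕ} (w : ℕ → Fin (b + 1))
    (hw : {j : ℕ | w j ≠ Fin.last b}.Infinite) : ℕ → Fin b :=
  fun i => (w (Nat.nth (fun j => w j ≠ Fin.last b) i)).castPred (Nat.nth_mem_of_infinite hw i)

/-! The word is obtained by filling the non-`b` places of a template `E` with the letters of `v` in
order (`overlay`), so its reduction is `v`. Only normality has to be arranged.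

Fix `m` and let `E` repeat the concatenation of all words of length `m` over `Fin (b + 1)`. If one
period has `R` non-`b` places, the filled `i`-th period depends only on the `i`-th `R`-block of `v`,
and these blocks are equidistributed. For `ℓ ∣ m`, the aligned places of `E` with the `b`-pattern of
`x` have proportion `b ^ k / (b + 1) ^ ℓ`, where `k` is the number of non-`b` letters of `x`. A
proportion `b ^ (-k)` of the fillings shows `x` at such a place, so the frequency is exactly `1 / (b
+ 1) ^ ℓ` (`hasUniformBlocks_overlay`).

To reach all `ℓ`, use `m = (j + 1)!` on the `j`-th of rapidly growing intervals. Each template has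
exactly density `b / (b + 1)` of non-`b` symbols over full periods, so if intervals end at common
periods, the spliced filling agrees on each interval with the filling of one fixed template
(`overlay_splice`). A discrepancy estimate then concludes (`hasUniformBlocks_of_stages`). -/

/-! ### Aligned blocks and counting functions -/

/-- The `k`-th aligned block of length `ℓ` of the infinite word `u`. -/
def block {α : Type*} (u : ℕ → α) (ℓ k : ℕ) : Fin ℓ → α := fun s => u (ℓ * k + s)

/-- The aligned blocks of length `ℓ` of `u` are asymptotically equidistributed. -/
def HasUniformBlocks {α : Type*} [Fintype α] [DecidableEq α] (u : ℕ → α) (ℓ : ℕ) : Prop :=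
  ∀ x : Fin ℓ → α, Tendsto (fun n : ℕ => (Nat.count (fun k => block u ℓ k = x) n : ℝ) / n) atTop
    (𝓝 (1 / (Fintype.card α : ℝ) ^ ℓ))

theorem alignedOcc_wordPrefix {α : Type*} [DecidableEq α] (u : ℕ → α) (v : List α)
    (hv : 1 ≤ v.length) (n : ℕ) :
    alignedOcc (wordPrefix u (v.length * n)) v =
      Nat.count (fun k => block u v.length k = v.get) n := by
  have key : ∀ k, v.length * k + v.length ≤ v.length * n →
      ((((wordPrefix u (v.length * n)).drop (v.length * k)).take v.length = v) ↔
        block u v.length k = v.get) := by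
    intro k hk
    constructor
    · intro h
      funext s
      have h1 := List.getElem_of_eq h.symm s.2
      rw [List.get_eq_getElem, h1]
      simp [wordPrefix, block]
    · intro h
      apply List.ext_getElem
      · simp [wordPrefix]; omega
      · intro i h1 h2
        have := congrFun h ⟨i, h2⟩
        rw [List.get_eq_getElem] at this
        rw [← this]
        simp [wordPrefix, block]
  rw [Nat.count_eq_card_filter_range, alignedOcc]
  symm
  refine Finset.card_nbij (fun k => v.length * k) ?_ ?_ ?_
  · intro k hk
    simp only [Finset.mem_range, Finset.coe_filter, Set.mem_ofPred_eq] at hk ⊢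
    have h1 : v.length * k + v.length ≤ v.length * n := by nlinarith [hk.1]
    refine ⟨?_, dvd_mul_right _ _, (key k h1).2 hk.2⟩
    simp [wordPrefix]; omega
  · intro a _ c _ h
    exact Nat.eq_of_mul_eq_mul_left hv h
  · intro i hi
    simp only [Finset.mem_range, Finset.coe_filter, Set.mem_ofPred_eq] at hi
    obtain ⟨h1, ⟨k, rfl⟩, h3⟩ := hi
    have h2 : v.length * k + v.length ≤ v.length * n := by
      simp [wordPrefix] at h1; omega
    refine ⟨k, ?_, rfl⟩
    simp only [Finset.mem_range, Finset.coe_filter, Set.mem_ofPred_eq]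
    exact ⟨by nlinarith, (key k h2).1 h3⟩

theorem isSimplyNormal_iff_hasUniformBlocks {α : Type*} [Fintype α] [DecidableEq α] (u : ℕ → α)
    {ℓ : ℕ} (hℓ : 1 ≤ ℓ) : IsSimplyNormal u ℓ ↔ HasUniformBlocks u ℓ := by
  constructor
  · intro h x
    obtain ⟨v, hv, rfl⟩ : ∃ v : List α, ∃ hv : v.length = ℓ, x = fun s => v.get (s.cast hv.symm) :=
      ⟨List.ofFn x, by simp, by ext; simp⟩
    subst hv
    refine (h v rfl).congr fun n => ?_
    rw [alignedOcc_wordPrefix u v hℓ]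
    rfl
  · rintro h v rfl
    refine (h v.get).congr fun n => ?_
    rw [alignedOcc_wordPrefix u v hℓ]

theorem count_mul (p : ℕ → Prop) [DecidablePred p] (q n : ℕ) :
    Nat.count p (q * n) = ∑ i ∈ Finset.range n, Nat.count (fun k => p (q * i + k)) q := by
  induction n with
  | zero => simp
  | succ n ih => rw [Finset.sum_range_succ, ← ih, Nat.mul_succ, Nat.count_add]

theorem count_congr {p p' : ℕ → Prop} [DecidablePred p] [DecidablePred p'] {n : ℕ}
    (h : ∀ k < n, (p k ↔ p' k)) : Nat.count p n = Nat.count p' n := by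
  rw [Nat.count_eq_card_filter_range, Nat.count_eq_card_filter_range]
  congr 1
  exact Finset.filter_congr fun k hk => h k (Finset.mem_range.1 hk)

/-- A counting function with a density along multiples of `q` has that density. -/
theorem tendsto_count_div_of_mul {p : ℕ → Prop} [DecidablePred p] {q : ℕ} (hq : 0 < q) {c : ℝ}
    (h : Tendsto (fun n : ℕ => (Nat.count p (q * n) : ℝ) / n) atTop (𝓝 (q * c))) :
    Tendsto (fun n : ℕ => (Nat.count p n : ℝ) / n) atTop (𝓝 c) := by
  have hq' : (0 : ℝ) < q := by exact_mod_cast hq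
  have hdiv : Tendsto (fun n : ℕ => n / q) atTop atTop := Nat.tendsto_div_const_atTop hq.ne'
  have hfl : Tendsto (fun n : ℕ => ((n / q : ℕ) : ℝ) / n) atTop (𝓝 (1 / q)) := by
    have h1 := (tendsto_nat_floor_mul_div_atTop (R := ℝ) (a := 1 / q) (by positivity)).comp
      tendsto_natCast_atTop_atTop
    refine h1.congr fun n => ?_
    simp only [Function.comp_apply]
    rw [one_div_mul_eq_div, Nat.floor_div_eq_div]
  have hlow : Tendsto (fun n : ℕ => (Nat.count p (q * (n / q)) : ℝ) / n) atTop (𝓝 c) := by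
    have h1 := (h.comp hdiv).mul hfl
    rw [show (q : ℝ) * c * (1 / q) = c by field_simp] at h1
    refine h1.congr' ?_
    filter_upwards [hdiv.eventually_gt_atTop 0] with n hn
    have : ((n / q : ℕ) : ℝ) ≠ 0 := by exact_mod_cast hn.ne'
    simp only [Function.comp_apply]
    field_simp
  have hup : Tendsto (fun n : ℕ => (Nat.count p (q * (n / q)) : ℝ) / n + (q : ℝ) / n) atTop
      (𝓝 c) := by
    simpa using hlow.add (tendsto_const_div_atTop_nhds_zero_nat (q : ℝ))
  refine tendsto_of_tendsto_of_tendsto_of_le_of_le hlow hup (fun n => ?_) (fun n => ?_)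
  · have := Nat.count_monotone p (Nat.mul_div_le n q)
    dsimp only
    gcongr
  · have h1 : n = q * (n / q) + n % q := (Nat.div_add_mod n q).symm
    have h2 : Nat.count p n ≤ Nat.count p (q * (n / q)) + q := by
      conv_lhs => rw [h1]
      rw [Nat.count_add]
      have := Nat.count_le (p := fun k => p (q * (n / q) + k)) (n := n % q)
      have := Nat.mod_lt n hq
      omega
    dsimp only
    rw [← add_div]
    gcongr
    exact_mod_cast h2

/-- Block averages of functions of the blocks of an equidistributed word converge. -/
theorem HasUniformBlocks.tendsto_average {α : Type*} [Fintype α] [DecidableEq α] {u : ℕ → α}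
    {ℓ : ℕ} (h : HasUniformBlocks u ℓ) (g : (Fin ℓ → α) → ℝ) :
    Tendsto (fun n : ℕ => (∑ i ∈ Finset.range n, g (block u ℓ i)) / n) atTop
      (𝓝 ((∑ x, g x) / (Fintype.card α : ℝ) ^ ℓ)) := by
  have h1 : Tendsto (fun n : ℕ => ∑ x, g x *
      ((Nat.count (fun k => block u ℓ k = x) n : ℝ) / n)) atTop
      (𝓝 (∑ x, g x * (1 / (Fintype.card α : ℝ) ^ ℓ))) :=
    tendsto_finsetSum _ fun x _ => (h x).const_mul (g x)
  rw [← Finset.sum_mul, mul_one_div] at h1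
  refine h1.congr fun n => ?_
  simp_rw [← mul_div_assoc]
  rw [← Finset.sum_div]
  congr 1
  simp_rw [Nat.count_eq_card_filter_range]
  rw [← Finset.sum_fiberwise (Finset.range n) (block u ℓ)]
  refine Finset.sum_congr rfl fun x _ => ?_
  rw [Finset.sum_congr rfl (g := fun _ => g x)
    (fun i hi => by rw [(Finset.mem_filter.1 hi).2]), Finset.sum_const, nsmul_eq_mul, mul_comm]

/-- Restriction along an injection is equidistributed. -/
theorem card_comp_mem_mul {α ι κ : Type*} [Fintype α] [DecidableEq α] [Fintype ι] [Fintype κ]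
    [DecidableEq ι] [DecidableEq κ] {f : ι → κ} (hf : f.Injective) (S : Finset (ι → α)) :
    (Finset.univ.filter fun u : κ → α => u ∘ f ∈ S).card * Fintype.card α ^ Fintype.card ι =
      S.card * Fintype.card α ^ Fintype.card κ := by
  classical
  have h1 : ∀ y : ι → α, (Finset.univ.filter fun u : κ → α => u ∘ f = y).card *
      Fintype.card α ^ Fintype.card ι = Fintype.card α ^ Fintype.card κ := by
    intro y
    let e := Equiv.ofInjective f hf
    have h2 : (Finset.univ.filter fun u : κ → α => u ∘ f = y).card =
        Fintype.card α ^ Fintype.card {k // ¬ k ∈ Set.range f} := by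
      rw [← Fintype.card_fun, ← Fintype.card_subtype]
      refine Fintype.card_congr (Equiv.trans (Equiv.subtypeEquivRight fun u => ?_)
        (Equiv.subtypePreimage (fun k => k ∈ Set.range f) (y ∘ e.symm)))
      constructor
      · rintro rfl
        funext ⟨k, i, hi⟩
        subst hi
        simp [e, Equiv.ofInjective_symm_apply]
      · intro h
        funext i
        have := congrFun h (e i)
        simpa [e] using this
    rw [h2, ← pow_add]
    congr 1
    have h3 := Fintype.card_subtype_compl (fun k => k ∈ Set.range f)
    have h4 : Fintype.card {k // k ∈ Set.range f} = Fintype.card ι := (Fintype.card_congr e).symm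
    have h5 := Fintype.card_subtype_le (fun k => k ∈ Set.range f)
    omega
  rw [Finset.card_eq_sum_card_fiberwise (f := fun u : κ → α => u ∘ f) (t := S)
    (fun u hu => by simpa using hu), Finset.sum_mul, Finset.sum_congr rfl (g := fun _ =>
      Fintype.card α ^ Fintype.card κ), Finset.sum_const, smul_eq_mul]
  intro y hy
  rw [← h1 y, Finset.filter_filter]
  congr 2
  ext u
  simp only [Finset.mem_filter, Finset.mem_univ, true_and]
  constructor
  · exact fun h => h.2
  · rintro rfl
    exact ⟨hy, rfl⟩

/-! ### The periodic word of all words of length `m` -/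

/-- A periodic enumeration of all words of length `m`. -/
noncomputable def enumWords (α : Type*) [Fintype α] [DecidableEq α] [Nonempty α] (m n : ℕ) :
    Fin m → α :=
  (Fintype.equivFin (Fin m → α)).symm
    ⟨n % Fintype.card (Fin m → α), Nat.mod_lt _ Fintype.card_pos⟩

/-- The concatenation of all words of length `m`, repeated periodically. -/
noncomputable def allWords (α : Type*) [Fintype α] [DecidableEq α] [Nonempty α] (m : ℕ) [NeZero m]
    (i : ℕ) : α :=
  enumWords α m (i / m) (Fin.ofNat m i)

section allWords

variable (α : Type*) [Fintype α] [DecidableEq α] [Nonempty α]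

theorem sum_enumWords (m : ℕ) (g : (Fin m → α) → ℕ) :
    ∑ i ∈ Finset.range (Fintype.card α ^ m), g (enumWords α m i) = ∑ y, g y := by
  have hc : Fintype.card α ^ m = Fintype.card (Fin m → α) := by simp
  rw [hc, ← Fin.sum_univ_eq_sum_range (fun i => g (enumWords α m i)),
    ← Equiv.sum_comp (Fintype.equivFin (Fin m → α)).symm g]
  refine Finset.sum_congr rfl fun i _ => ?_
  simp only [enumWords]
  congr 2
  exact Fin.ext (Nat.mod_eq_of_lt i.2)

theorem allWords_add_period (m : ℕ) [NeZero m] (i : ℕ) :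
    allWords α m (m * Fintype.card α ^ m + i) = allWords α m i := by
  have hm : 0 < m := Nat.pos_of_ne_zero (NeZero.ne m)
  have hc : Fintype.card α ^ m = Fintype.card (Fin m → α) := by simp
  unfold allWords enumWords
  rw [show Fin.ofNat m (m * Fintype.card α ^ m + i) = Fin.ofNat m i by
    ext; simp [Fin.ofNat]]
  refine congrFun (congrArg _ (Fin.ext ?_)) _
  dsimp only
  rw [Nat.mul_add_div hm, hc, Nat.add_mod_left]

/-- As `ℓ ∣ m`, no aligned `ℓ`-block straddles two listed words. Each of the `q` aligned blocks
within a word is a restriction, equidistributed by `card_comp_mem_mul`. -/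
theorem count_block_allWords {m ℓ q : ℕ} [NeZero m] (hm : m = ℓ * q) (S : Finset (Fin ℓ → α)) :
    Nat.count (fun t => block (allWords α m) ℓ t ∈ S) (q * Fintype.card α ^ m) *
      Fintype.card α ^ ℓ = q * Fintype.card α ^ m * S.card := by
  subst hm
  have hpos : 0 < ℓ * q := Nat.pos_of_ne_zero (NeZero.ne _)
  have hlt : ∀ t : Fin q, ∀ s : Fin ℓ, ℓ * t + s < ℓ * q := fun t s =>
    calc ℓ * t + s < ℓ * (t + 1) := by have := s.2; rw [Nat.mul_succ]; omega
      _ ≤ ℓ * q := Nat.mul_le_mul_left _ t.2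
  have hb : ∀ i, ∀ t : Fin q, block (allWords α (ℓ * q)) ℓ (q * i + t) =
      enumWords α (ℓ * q) i ∘ fun s : Fin ℓ => ⟨ℓ * t + s, hlt t s⟩ := by
    intro i t
    funext s
    have e : ℓ * (q * i + t) + s = ℓ * q * i + (ℓ * t + s) := by ring
    simp only [block, allWords, Function.comp_apply, e]
    rw [Nat.mul_add_div hpos, Nat.div_eq_of_lt (hlt t s), add_zero]
    congr 1
    ext
    simp [Fin.ofNat, Nat.mod_eq_of_lt (hlt t s)]
  rw [count_mul]
  have h1 : ∀ i, Nat.count (fun k => block (allWords α (ℓ * q)) ℓ (q * i + k) ∈ S) q =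
      ∑ t : Fin q, if (enumWords α (ℓ * q) i ∘ fun s : Fin ℓ => ⟨ℓ * t + s, hlt t s⟩) ∈ S
        then 1 else 0 := by
    intro i
    rw [Nat.count_eq_card_filter_range, Finset.card_filter,
      ← Fin.sum_univ_eq_sum_range (fun k => if block (allWords α (ℓ * q)) ℓ (q * i + k) ∈ S
        then 1 else 0)]
    simp_rw [hb]
  simp_rw [h1]
  rw [sum_enumWords α (ℓ * q) (fun y => ∑ t : Fin q,
    if (y ∘ fun s : Fin ℓ => ⟨ℓ * t + s, hlt t s⟩) ∈ S then 1 else 0), Finset.sum_comm,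
    Finset.sum_mul, Finset.sum_congr rfl (g := fun _ => Fintype.card α ^ (ℓ * q) * S.card)]
  · simp [mul_assoc]
  · intro t _
    rw [← Finset.card_filter]
    have := card_comp_mem_mul (f := fun s : Fin ℓ => (⟨ℓ * t + s, hlt t s⟩ : Fin (ℓ * q)))
      (fun a c h => by simpa [Fin.ext_iff] using h) S
    rw [Fintype.card_fin, Fintype.card_fin] at this
    rw [this, mul_comm]

end allWords

/-! ### Filling a template with the letters of `v` -/

/-- Replace the symbols different from `b` in the template `E` by the successive letters of `v`. -/
def overlay {b : ℕ} (E : ℕ → Fin (b + 1)) (v : ℕ → Fin b) (i : ℕ) : Fin (b + 1) :=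
  if E i = Fin.last b then Fin.last b
  else (v (Nat.count (fun j => E j ≠ Fin.last b) i)).castSucc

theorem overlay_eq_last_iff {b : ℕ} (E : ℕ → Fin (b + 1)) (v : ℕ → Fin b) (i : ℕ) :
    overlay E v i = Fin.last b ↔ E i = Fin.last b := by
  unfold overlay
  split_ifs with h
  · simp [h]
  · simp [h, Fin.castSucc_ne_last]

theorem reduction_overlay {b : ℕ} (E : ℕ → Fin (b + 1)) (v : ℕ → Fin b)
    (hw : {j : ℕ | overlay E v j ≠ Fin.last b}.Infinite) : reduction (overlay E v) hw = v := by
  funext i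
  have h1 : overlay E v (Nat.nth (fun j => overlay E v j ≠ Fin.last b) i) ≠ Fin.last b :=
    Nat.nth_mem_of_infinite hw i
  have h2 := Nat.count_nth_of_infinite hw i
  apply Fin.castSucc_injective
  rw [reduction, Fin.castSucc_castPred]
  generalize Nat.nth (fun j => overlay E v j ≠ Fin.last b) i = k at h1 h2 ⊢
  rw [count_congr (fun k _ => (overlay_eq_last_iff E v k).not)] at h2
  rw [overlay, if_neg (mt (overlay_eq_last_iff E v _).2 h1)]
  exact congrArg (fun j => (v j).castSucc) h2

theorem card_sameTemplate {b ℓ : ℕ} (x : Fin ℓ → Fin (b + 1)) :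
    (Finset.univ.filter fun y : Fin ℓ → Fin (b + 1) =>
      ∀ s, (y s = Fin.last b ↔ x s = Fin.last b)).card =
      b ^ Fintype.card {s // x s ≠ Fin.last b} := by
  have h : (Finset.univ.filter fun y : Fin ℓ → Fin (b + 1) =>
      ∀ s, (y s = Fin.last b ↔ x s = Fin.last b)) =
      Fintype.piFinset fun s => if x s = Fin.last b then {Fin.last b}
        else Finset.univ.erase (Fin.last b) := by
    ext y
    simp only [Finset.mem_filter, Finset.mem_univ, true_and, Fintype.mem_piFinset]
    refine forall_congr' fun s => ?_
    split_ifs with hs <;> simp [hs]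
  rw [h, Fintype.card_piFinset, Fintype.card_subtype, ← Finset.prod_const, Finset.prod_filter]
  refine Finset.prod_congr rfl fun s _ => ?_
  by_cases hs : x s = Fin.last b <;> simp [hs]

/-- Among the fillings of a template, those showing `x` at a place where the template fits have
the expected density. -/
theorem card_overlay_eq {b R ℓ t : ℕ} [NeZero R] (E : ℕ → Fin (b + 1)) (x : Fin ℓ → Fin (b + 1))
    (hR : ∀ s : Fin ℓ, E (ℓ * t + s) ≠ Fin.last b →
      Nat.count (fun j => E j ≠ Fin.last b) (ℓ * t + s) < R) :
    (Finset.univ.filter fun u : Fin R → Fin b =>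
      block (overlay E fun i => u (Fin.ofNat R i)) ℓ t = x).card *
      b ^ Fintype.card {s // x s ≠ Fin.last b} =
      if ∀ s, (block E ℓ t s = Fin.last b ↔ x s = Fin.last b) then b ^ R else 0 := by
  split_ifs with hmatch
  · have hne : ∀ s : {s // x s ≠ Fin.last b}, E (ℓ * t + s.1) ≠ Fin.last b :=
      fun s h => s.2 ((hmatch s).1 h)
    let f : {s // x s ≠ Fin.last b} → Fin R := fun s =>
      ⟨Nat.count (fun j => E j ≠ Fin.last b) (ℓ * t + s.1), hR s (hne s)⟩
    have hf : f.Injective := by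
      -- Distinct non-`b` places have distinct ranks, so they receive different coordinates of `u`.
      intro s s' h
      have h1 := Nat.count_injective (hne s) (hne s') (Fin.mk.inj h)
      exact Subtype.ext (Fin.ext (by omega))
    have h1 := card_comp_mem_mul (α := Fin b) hf {fun s => (x s.1).castPred s.2}
    simp only [Finset.card_singleton, one_mul, Fintype.card_fin, Finset.mem_singleton] at h1
    rw [← h1]
    congr 2
    refine Finset.filter_congr fun u _ => ?_
    have hval : ∀ s : {s // x s ≠ Fin.last b},
        block (overlay E fun i => u (Fin.ofNat R i)) ℓ t s = (u (f s)).castSucc := by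
      intro s
      have : Fin.ofNat R (Nat.count (fun j => E j ≠ Fin.last b) (ℓ * t + s.1)) = f s :=
        Fin.ext (Nat.mod_eq_of_lt (f s).2)
      simp only [block, overlay]
      rw [if_neg (hne s), this]
    constructor
    · intro h
      funext s
      apply Fin.castSucc_injective
      rw [Fin.castSucc_castPred, Function.comp_apply, ← hval, h]
    · intro h
      funext s
      by_cases hs : x s = Fin.last b
      · rw [hs]
        exact (overlay_eq_last_iff _ _ _).2 ((hmatch s).2 hs)
      · have := congrFun h ⟨s, hs⟩
        rw [hval ⟨s, hs⟩]
        rw [Function.comp_apply] at this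
        rw [this, Fin.castSucc_castPred]
  · rw [Finset.filter_eq_empty_iff.2, Finset.card_empty, zero_mul]
    rintro u - rfl
    exact hmatch fun s => (overlay_eq_last_iff _ _ _).symm

theorem count_periodic {p : ℕ → Prop} [DecidablePred p] {Q : ℕ} (hp : ∀ i, p (Q + i) ↔ p i)
    (n j : ℕ) : Nat.count p (Q * n + j) = Nat.count p Q * n + Nat.count p j := by
  induction n with
  | zero => simp
  | succ n ih =>
    rw [show Q * (n + 1) + j = Q + (Q * n + j) by ring, Nat.count_add,
      count_congr (fun k _ => hp k), ih]
    ring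

/-- Occurrences of `x` within one filled period are a function of a single `R`-block of `v`, so
their average converges to the mean over all fillings; `hcount` evaluates that mean. -/
theorem hasUniformBlocks_overlay {b ℓ q R : ℕ} [NeZero b] [NeZero R] (hq : 0 < q)
    {E : ℕ → Fin (b + 1)} {v : ℕ → Fin b} (hE : ∀ i, E (ℓ * q + i) = E i)
    (hR : Nat.count (fun j => E j ≠ Fin.last b) (ℓ * q) = R)
    (hv : HasUniformBlocks v R)
    (hcount : ∀ x : Fin ℓ → Fin (b + 1),
      Nat.count (fun t => ∀ s, (block E ℓ t s = Fin.last b ↔ x s = Fin.last b)) q * (b + 1) ^ ℓ =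
        q * b ^ Fintype.card {s // x s ≠ Fin.last b}) :
    HasUniformBlocks (overlay E v) ℓ := by
  intro x
  have hb : (0 : ℕ) < b := Nat.pos_of_ne_zero (NeZero.ne b)
  have hcnt : ∀ i j, Nat.count (fun j => E j ≠ Fin.last b) (ℓ * q * i + j) =
      R * i + Nat.count (fun j => E j ≠ Fin.last b) j := fun i j => by
    rw [count_periodic (fun k => by rw [hE]), hR]
  have hper : ∀ i j, E (ℓ * q * i + j) = E j := by
    intro i j
    induction i with
    | zero => simp
    | succ i ih => rw [← ih, ← hE (ℓ * q * i + j)]; congr 1; ring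
  have hlt : ∀ k < q, ∀ s : Fin ℓ, ℓ * k + s < ℓ * q := fun t ht s =>
    calc ℓ * t + s < ℓ * (t + 1) := by have := s.2; rw [Nat.mul_succ]; omega
      _ ≤ ℓ * q := Nat.mul_le_mul_left _ ht
  have hcR : ∀ j < ℓ * q, E j ≠ Fin.last b →
      Nat.count (fun j => E j ≠ Fin.last b) j < R := fun j hj h => by
    rw [← hR]; exact Nat.count_strict_mono h hj
  let g : (Fin R → Fin b) → ℕ := fun u =>
    Nat.count (fun k => block (overlay E fun i => u (Fin.ofNat R i)) ℓ k = x) q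
  have hsplit : ∀ n, Nat.count (fun k => block (overlay E v) ℓ k = x) (q * n) =
      ∑ i ∈ Finset.range n, g (block v R i) := by
    intro n
    rw [count_mul]
    refine Finset.sum_congr rfl fun i _ => count_congr fun k hk => ?_
    suffices h : block (overlay E v) ℓ (q * i + k) =
        block (overlay E fun j => block v R i (Fin.ofNat R j)) ℓ k by rw [h]
    funext s
    simp only [block, overlay]
    rw [show ℓ * (q * i + k) + (s : ℕ) = ℓ * q * i + (ℓ * k + s) by ring, hper, hcnt]
    split_ifs with h
    · rfl
    · simp [Fin.ofNat, Nat.mod_eq_of_lt (hcR _ (hlt k hk s) h)]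
  -- Double counting over fillings and places. The factor `b ^ k`, with `k` the number of non-`b`
  -- letters of `x`, keeps the identity in `ℕ` and is cancelled afterwards.
  have hsum : (∑ u, g u) * (b + 1) ^ ℓ = q * b ^ R := by
    have h1 : (∑ u, g u) * b ^ Fintype.card {s // x s ≠ Fin.last b} =
        Nat.count (fun t => ∀ s, (block E ℓ t s = Fin.last b ↔ x s = Fin.last b)) q * b ^ R := by
      simp_rw [g, Nat.count_eq_card_filter_range, Finset.card_filter]
      rw [Finset.sum_comm, Finset.sum_mul, Finset.sum_mul]
      refine Finset.sum_congr rfl fun t ht => ?_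
      rw [← Finset.card_filter, card_overlay_eq E x
        (fun s h => hcR _ (hlt t (Finset.mem_range.1 ht) s) h), ite_mul, one_mul, zero_mul]
    refine Nat.eq_of_mul_eq_mul_right
      (pow_pos hb (Fintype.card {s // x s ≠ Fin.last b})) ?_
    calc _ = (∑ u, g u) * b ^ Fintype.card {s // x s ≠ Fin.last b} * (b + 1) ^ ℓ := by ring
      _ = _ := by rw [h1, mul_right_comm, hcount]; ring
  refine tendsto_count_div_of_mul hq ?_
  have h1 := hv.tendsto_average fun u => (g u : ℝ)
  have h2 : (∑ u, (g u : ℝ)) / (Fintype.card (Fin b) : ℝ) ^ R =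
      q * (1 / (Fintype.card (Fin (b + 1)) : ℝ) ^ ℓ) := by
    have h3 : (∑ u, (g u : ℝ)) * ((b : ℝ) + 1) ^ ℓ = q * (b : ℝ) ^ R := by exact_mod_cast hsum
    have hb' : (b : ℝ) ≠ 0 := by exact_mod_cast hb.ne'
    rw [Fintype.card_fin, Fintype.card_fin, mul_one_div, div_eq_div_iff (by positivity)
      (by positivity)]
    exact_mod_cast h3
  rw [h2] at h1
  refine h1.congr fun n => ?_
  rw [hsplit]
  push_cast
  rfl

/-! ### Templates made of all words of length `m` -/

section template

variable {b m : ℕ} [NeZero m]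

theorem count_ne_last_allWords [NeZero b] :
    Nat.count (fun j => allWords (Fin (b + 1)) m j ≠ Fin.last b) (m * (b + 1) ^ m) * (b + 1) =
      b * (m * (b + 1) ^ m) := by
  have h0 : (0 : Fin (b + 1)) ≠ Fin.last b := (Fin.last_pos' (n := b)).ne
  -- The case `ℓ = 1`, where the one-letter word `0` represents the non-`b` pattern.
  have h := count_block_allWords (Fin (b + 1)) (m := m) (ℓ := 1) (q := m) (by simp)
    (Finset.univ.filter fun y => ∀ s, (y s = Fin.last b ↔ (0 : Fin 1 → Fin (b + 1)) s = Fin.last b))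
  rw [card_sameTemplate] at h
  simp [h0, block] at h
  rw [h, mul_comm]

theorem hasUniformBlocks_overlay_allWords [NeZero b] {ℓ : ℕ} (hℓ : ℓ ∣ m) {v : ℕ → Fin b}
    (hv : ∀ R, 1 ≤ R → HasUniformBlocks v R) :
    HasUniformBlocks (overlay (allWords (Fin (b + 1)) m) v) ℓ := by
  obtain ⟨q, hq⟩ := hℓ
  have hm : 0 < m := Nat.pos_of_ne_zero (NeZero.ne m)
  have hb : 0 < b := Nat.pos_of_ne_zero (NeZero.ne b)
  have hq0 : 0 < q := Nat.pos_of_ne_zero (by rintro rfl; simp at hq; omega)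
  have hQ : ℓ * (q * (b + 1) ^ m) = m * (b + 1) ^ m := by rw [← mul_assoc, ← hq]
  have hRpos : 0 < Nat.count (fun j => allWords (Fin (b + 1)) m j ≠ Fin.last b)
      (m * (b + 1) ^ m) := by
    refine Nat.pos_of_mul_pos_right (b := b + 1) ?_
    rw [count_ne_last_allWords]
    positivity
  have : NeZero (Nat.count (fun j => allWords (Fin (b + 1)) m j ≠ Fin.last b)
      (m * (b + 1) ^ m)) := ⟨hRpos.ne'⟩
  refine hasUniformBlocks_overlay (q := q * (b + 1) ^ m)
    (R := Nat.count (fun j => allWords (Fin (b + 1)) m j ≠ Fin.last b) (m * (b + 1) ^ m))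
    (by positivity) ?_ (by rw [hQ]) (hv _ hRpos) ?_
  · intro i
    rw [hQ]
    simpa using allWords_add_period (Fin (b + 1)) m i
  · intro x
    have h := count_block_allWords (Fin (b + 1)) hq
      (Finset.univ.filter fun y => ∀ s, (y s = Fin.last b ↔ x s = Fin.last b))
    rw [card_sameTemplate] at h
    simpa using h

end template

/-! ### Splicing words on rapidly growing intervals -/

/-- The index of the interval `[S j, S (j + 1))` containing `i`. -/
def stage (S : ℕ → ℕ) (i : ℕ) : ℕ := Nat.findGreatest (fun j => S j ≤ i) i

theorem stage_eq {S : ℕ → ℕ} (hS : StrictMono S) {i j : ℕ} (h1 : S j ≤ i) (h2 : i < S (j + 1)) :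
    stage S i = j := by
  rw [stage, Nat.findGreatest_eq_iff]
  exact ⟨(hS.le_apply).trans h1, fun _ => h1, fun n hn _ h =>
    absurd (hS.monotone hn) (by simp only [Nat.succ_eq_add_one]; omega)⟩

theorem stage_spec {S : ℕ → ℕ} (hS : StrictMono S) (h0 : S 0 = 0) (i : ℕ) :
    S (stage S i) ≤ i ∧ i < S (stage S i + 1) := by
  refine ⟨Nat.findGreatest_spec (P := fun j => S j ≤ i) (Nat.zero_le i) (by simp [h0]), ?_⟩
  by_contra! h
  have h1 : stage S i + 1 ≤ i := (hS.le_apply).trans h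
  exact Nat.findGreatest_is_greatest (Nat.lt_succ_self (stage S i)) h1 h

/-- A word that follows better and better equidistributed words on rapidly growing intervals has
equidistributed blocks. -/
theorem hasUniformBlocks_of_stages {α : Type*} [Fintype α] [DecidableEq α]
    {w : ℕ → ℕ → α} {W : ℕ → α} {S : ℕ → ℕ} (hS : StrictMono S) (h0 : S 0 = 0)
    (hdvd : ∀ j ℓ, 1 ≤ ℓ → ℓ ≤ j + 1 → ℓ ∣ S j) (hgrow : ∀ j, (j + 1) * S j ≤ S (j + 1))
    (hagree : ∀ j i, S j ≤ i → i < S (j + 1) → W i = w j i)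
    (hclose : ∀ j ℓ, 1 ≤ j → 1 ≤ ℓ → ℓ ≤ j + 1 → ∀ (x : Fin ℓ → α) (n : ℕ), S j ≤ ℓ * n →
      |(Nat.count (fun k => block (w j) ℓ k = x) n : ℝ) - n * (1 / (Fintype.card α : ℝ) ^ ℓ)| ≤
        n / (j + 1))
    {ℓ : ℕ} (hℓ : 1 ≤ ℓ) : HasUniformBlocks W ℓ := by
  intro x
  set β : ℝ := 1 / (Fintype.card α : ℝ) ^ ℓ with hβ
  have hcard : (1 : ℝ) ≤ Fintype.card α := by
    have : Nonempty α := ⟨W 0⟩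
    exact_mod_cast Fintype.card_pos (α := α)
  have hβ0 : 0 ≤ β := by positivity
  have hβ1 : β ≤ 1 := by
    rw [hβ, div_le_one (by positivity)]
    exact one_le_pow₀ hcard
  set c : ℕ → ℕ := fun n => Nat.count (fun k => block W ℓ k = x) n with hc
  have htriv : ∀ n, |(c n : ℝ) - n * β| ≤ n := by
    intro n
    have h1 : (c n : ℝ) ≤ n := Nat.cast_le.2 (Nat.count_le _)
    have h2 : (0 : ℝ) ≤ c n := by positivity
    have h3 : (n : ℝ) * β ≤ n := mul_le_of_le_one_right (by positivity) hβ1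
    have h4 : (0 : ℝ) ≤ n * β := by positivity
    rw [abs_le]
    constructor <;> linarith
  have hs : ∀ j, ℓ ≤ j + 1 → ℓ * (S j / ℓ) = S j := fun j hj => Nat.mul_div_cancel' (hdvd j ℓ hℓ hj)
  -- Beyond `S j` the counts for `W` and `w j` grow equally; the discrepancies of `w j` at both ends
  -- contribute at most `2 * n / (j + 1)`.
  have hstep : ∀ j n, 1 ≤ j → ℓ ≤ j + 1 → S j ≤ ℓ * n → ℓ * n ≤ S (j + 1) →
      |(c n : ℝ) - n * β| ≤ |(c (S j / ℓ) : ℝ) - (S j / ℓ : ℕ) * β| + 2 * n / (j + 1) := by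
    intro j n hj hℓj h1 h2
    have hle : S j / ℓ ≤ n := Nat.le_of_mul_le_mul_left (by rw [hs j hℓj]; exact h1) hℓ
    obtain ⟨r, rfl⟩ := Nat.exists_eq_add_of_le hle
    have e1 : ((c (S j / ℓ + r) : ℕ) : ℝ) - c (S j / ℓ) =
        (Nat.count (fun k => block (w j) ℓ k = x) (S j / ℓ + r) : ℝ) -
          Nat.count (fun k => block (w j) ℓ k = x) (S j / ℓ) := by
      simp only [hc]
      rw [Nat.count_add, Nat.count_add]
      push_cast
      rw [add_sub_cancel_left, add_sub_cancel_left, Nat.cast_inj]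
      refine count_congr fun k hk => ?_
      suffices h : block W ℓ (S j / ℓ + k) = block (w j) ℓ (S j / ℓ + k) by rw [h]
      funext s
      have hlt : ℓ * (S j / ℓ + k) + s < ℓ * (S j / ℓ + r) :=
        calc ℓ * (S j / ℓ + k) + s < ℓ * (S j / ℓ + k + 1) := by
              have := s.2; rw [Nat.mul_succ]; omega
          _ ≤ _ := Nat.mul_le_mul_left _ (by omega)
      refine hagree j _ ?_ (hlt.trans_le h2)
      rw [mul_add, hs j hℓj, add_assoc]
      exact Nat.le_add_right _ _
    have a1 := hclose j ℓ hj hℓ hℓj x (S j / ℓ + r) h1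
    have a2 := hclose j ℓ hj hℓ hℓj x (S j / ℓ) (hs j hℓj).ge
    have a3 : ((S j / ℓ : ℕ) : ℝ) / (j + 1) ≤ (S j / ℓ + r : ℕ) / (j + 1) := by
      gcongr
    have a4 : 2 * ((S j / ℓ + r : ℕ) : ℝ) / (j + 1) =
        (S j / ℓ + r : ℕ) / (j + 1) + (S j / ℓ + r : ℕ) / (j + 1) := by ring
    have a5 := le_abs_self ((c (S j / ℓ) : ℝ) - (S j / ℓ : ℕ) * β)
    have a6 := neg_abs_le ((c (S j / ℓ) : ℝ) - (S j / ℓ : ℕ) * β)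
    rw [abs_le] at a1 a2 ⊢
    rw [a4]
    constructor <;> linarith [a1.1, a1.2, a2.1, a2.2]
  -- Two steps back, to `S i`, where the trivial bound suffices because `S i` is at most `S (i + 1)
  -- / (i + 1)`. The constant is `5 = 1 + 2 + 2`.
  have hbound : ∀ i n, 1 ≤ i → ℓ ≤ i + 1 → S (i + 1) ≤ ℓ * n → ℓ * n ≤ S (i + 1 + 1) →
      |(c n : ℝ) - n * β| ≤ 5 * n / (i + 1) := by
    intro i n hi hℓi h1 h2
    have b1 := hstep (i + 1) n (by omega) (by omega) h1 h2
    have b2 := hstep i (S (i + 1) / ℓ) hi hℓi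
      (by rw [hs (i + 1) (by omega)]; exact hS.monotone (by omega)) (hs (i + 1) (by omega)).le
    have b3 := htriv (S i / ℓ)
    have b4 : ((S i / ℓ : ℕ) : ℝ) ≤ (S (i + 1) / ℓ : ℕ) / (i + 1) := by
      rw [le_div_iff₀ (by positivity)]
      have : S i / ℓ * (i + 1) ≤ S (i + 1) / ℓ := by
        refine Nat.le_of_mul_le_mul_left ?_ hℓ
        rw [hs (i + 1) (by omega), ← mul_assoc, hs i hℓi, mul_comm]
        exact hgrow i
      exact_mod_cast this
    have b5 : ((S (i + 1) / ℓ : ℕ) : ℝ) / (i + 1) ≤ n / (i + 1) := by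
      have : S (i + 1) / ℓ ≤ n :=
        Nat.le_of_mul_le_mul_left (by rw [hs (i + 1) (by omega)]; exact h1) hℓ
      gcongr
    have b6 : 2 * (n : ℝ) / ((i + 1 : ℕ) + 1) ≤ 2 * n / (i + 1) := by
      gcongr
      linarith
    have b7 : 5 * (n : ℝ) / (i + 1) = 3 * (n / (i + 1)) + 2 * n / (i + 1) := by ring
    have b8 : 2 * ((S (i + 1) / ℓ : ℕ) : ℝ) / (i + 1) = 2 * ((S (i + 1) / ℓ : ℕ) / (i + 1)) := by
      ring
    linarith
  rw [Metric.tendsto_atTop]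
  intro ε hε
  obtain ⟨J, hJ⟩ := exists_nat_gt (5 / ε)
  -- This puts `ℓ * n` in a stage `i + 1` with `J + ℓ ≤ i`, so that `hbound` applies.
  refine ⟨S (J + ℓ + 1) + 1, fun n hn => ?_⟩
  obtain ⟨h1, h2⟩ := stage_spec hS h0 (ℓ * n)
  have h3 : J + ℓ + 1 ≤ stage S (ℓ * n) := by
    have : S (J + ℓ + 1) < S (stage S (ℓ * n) + 1) :=
      lt_of_le_of_lt (by nlinarith) h2
    have := hS.lt_iff_lt.1 this
    omega
  obtain ⟨i, hi⟩ := Nat.exists_eq_add_of_le' (show 1 ≤ stage S (ℓ * n) by omega)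
  rw [hi] at h1 h2 h3
  have h4 := hbound i n (by omega) (by omega) h1 h2.le
  have hn0 : (0 : ℝ) < n := by exact_mod_cast (by omega : 0 < n)
  have h5 : (J : ℝ) < i + 1 := by exact_mod_cast (by omega : J < i + 1)
  rw [Real.dist_eq, show (c n : ℝ) / n - β = (c n - n * β) / n by field_simp, abs_div,
    abs_of_pos hn0, div_lt_iff₀ hn0]
  refine h4.trans_lt ?_
  rw [div_lt_iff₀ (by positivity)]
  rw [div_lt_iff₀ hε] at hJ
  nlinarith [mul_lt_mul_of_pos_right h5 hε]

theorem HasUniformBlocks.eventually_abs_sub_le {α : Type*} [Fintype α] [DecidableEq α] {u : ℕ → α}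
    {ℓ : ℕ} (h : HasUniformBlocks u ℓ) {ε : ℝ} (hε : 0 < ε) :
    ∀ᶠ n in atTop, ∀ x : Fin ℓ → α, |(Nat.count (fun k => block u ℓ k = x) n : ℝ) -
      n * (1 / (Fintype.card α : ℝ) ^ ℓ)| ≤ n * ε := by
  rw [eventually_all]
  intro x
  filter_upwards [(Metric.tendsto_nhds.1 (h x)) ε hε, eventually_gt_atTop 0] with n hn hn0
  have hn0 : (0 : ℝ) < n := by exact_mod_cast hn0
  rw [Real.dist_eq] at hn
  rw [show ∀ a β : ℝ, a - n * β = n * (a / n - β) by intros; field_simp, abs_mul, abs_of_pos hn0]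
  gcongr

/-- Rapidly growing interval endpoints with prescribed divisibility and lower bounds. -/
def stagePoint (Q T : ℕ → ℕ) : ℕ → ℕ
  | 0 => 0
  | j + 1 => Q (j + 1) * ((j + 1) * stagePoint Q T j + (j + 2) * T (j + 1) + 1)

section stagePoint

variable {Q T : ℕ → ℕ}

theorem dvd_stagePoint (j : ℕ) : Q j ∣ stagePoint Q T j := by
  cases j with
  | zero => exact dvd_zero _
  | succ j => exact dvd_mul_right _ _

theorem lt_stagePoint_succ (hQ : ∀ j, 0 < Q j) (j : ℕ) :
    (j + 1) * stagePoint Q T j + (j + 2) * T (j + 1) < stagePoint Q T (j + 1) :=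
  Nat.le_mul_of_pos_left _ (hQ (j + 1))

theorem strictMono_stagePoint (hQ : ∀ j, 0 < Q j) : StrictMono (stagePoint Q T) :=
  strictMono_nat_of_lt_succ fun j => by
    have := lt_stagePoint_succ (T := T) hQ j
    nlinarith [Nat.zero_le (j * stagePoint Q T j), Nat.zero_le ((j + 2) * T (j + 1))]

end stagePoint

/-- The template that follows the words `E j` on the successive intervals `[S j, S (j + 1))`. -/
def splice {α : Type*} (S : ℕ → ℕ) (E : ℕ → ℕ → α) (i : ℕ) : α := E (stage S i) i

theorem splice_eq {α : Type*} {S : ℕ → ℕ} (hS : StrictMono S) (E : ℕ → ℕ → α) {i j : ℕ}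
    (h1 : S j ≤ i) (h2 : i < S (j + 1)) : splice S E i = E j i := by
  rw [splice, stage_eq hS h1 h2]

/-- If the templates have the same density of non-`b` symbols up to the ends of the intervals, then
the overlay of the spliced template splices the overlays. -/
theorem overlay_splice {b : ℕ} {S : ℕ → ℕ} (hS : StrictMono S) (h0 : S 0 = 0)
    {E : ℕ → ℕ → Fin (b + 1)}
    (hE : ∀ j, Nat.count (fun k => E j k ≠ Fin.last b) (S j) * (b + 1) = b * S j)
    (hE' : ∀ j, Nat.count (fun k => E j k ≠ Fin.last b) (S (j + 1)) * (b + 1) = b * S (j + 1))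
    (v : ℕ → Fin b) {i j : ℕ} (h1 : S j ≤ i) (h2 : i < S (j + 1)) :
    overlay (splice S E) v i = overlay (E j) v i := by
  have hext : ∀ j, Nat.count (fun k => splice S E k ≠ Fin.last b) (S j) =
      Nat.count (fun k => E j k ≠ Fin.last b) (S j) →
      ∀ i, S j ≤ i → i ≤ S (j + 1) → Nat.count (fun k => splice S E k ≠ Fin.last b) i =
        Nat.count (fun k => E j k ≠ Fin.last b) i := by
    intro j hj i h1 h2
    obtain ⟨r, rfl⟩ := Nat.exists_eq_add_of_le h1
    rw [Nat.count_add, Nat.count_add, hj, Nat.add_left_cancel_iff]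
    exact count_congr fun k hk => by rw [splice_eq hS E (Nat.le_add_right _ _) (by omega)]
  have hstart : ∀ j, Nat.count (fun k => splice S E k ≠ Fin.last b) (S j) =
      Nat.count (fun k => E j k ≠ Fin.last b) (S j) := by
    intro j
    induction j with
    | zero => simp [h0]
    | succ j ih =>
      rw [hext j ih _ (hS.monotone (Nat.le_succ j)) le_rfl]
      -- At the common endpoint both templates have used the same number of letters of `v`.
      exact Nat.eq_of_mul_eq_mul_right (Nat.succ_pos b) ((hE' j).trans (hE (j + 1)).symm)
  rw [overlay, overlay, splice_eq hS E h1 h2, hext j (hstart j) i h1 h2.le]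

theorem HasUniformBlocks.infinite {α : Type*} [Fintype α] [DecidableEq α] {u : ℕ → α}
    (h : HasUniformBlocks u 1) (a : α) : {j | u j = a}.Infinite := by
  intro hfin
  obtain ⟨N, hN⟩ := hfin.bddAbove
  have hα : Nonempty α := ⟨a⟩
  have hcard : (0 : ℝ) < Fintype.card α := by exact_mod_cast Fintype.card_pos
  have h1 : Tendsto (fun n : ℕ => ((N + 1 : ℕ) : ℝ) / n) atTop (𝓝 0) :=
    tendsto_const_div_atTop_nhds_zero_nat _
  have h2 := le_of_tendsto_of_tendsto' (h fun _ => a) h1 fun n => by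
    gcongr
    rw [Nat.count_eq_card_filter_range]
    refine (Finset.card_le_card (t := Finset.range (N + 1)) fun k hk => ?_).trans
      (Finset.card_range _).le
    have h3 : u k = a := by
      simpa [block] using congrFun (Finset.mem_filter.1 hk).2 0
    exact Finset.mem_range.2 (Nat.lt_succ_of_le (hN h3))
  have h3 : 0 < 1 / (Fintype.card α : ℝ) ^ 1 := by positivity
  linarith

/-! ### The main theorem -/

theorem theorem1 (b : ℕ) (v : ℕ → Fin b) (hv : IsNormalWord v) :
    ∃ w : ℕ → Fin (b + 1),
      IsNormalWord w ∧
      {j : ℕ | w j = Fin.last b}.Infinite ∧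
      ∃ hw : {j : ℕ | w j ≠ Fin.last b}.Infinite, reduction w hw = v := by
  have hb : NeZero b := ⟨fun h => (h ▸ v 0 : Fin 0).elim0⟩
  have hv' : ∀ R, 1 ≤ R → HasUniformBlocks v R := fun R hR =>
    (isSimplyNormal_iff_hasUniformBlocks v hR).1 (hv R hR)
  have hfac : ∀ j : ℕ, NeZero (j + 1).factorial := fun j => ⟨(Nat.factorial_pos _).ne'⟩
  let E : ℕ → ℕ → Fin (b + 1) := fun j => allWords (Fin (b + 1)) (j + 1).factorial
  let Q : ℕ → ℕ := fun j => (j + 1).factorial * (b + 1) ^ (j + 1).factorial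
  have hQ : ∀ j, 0 < Q j := fun j => by positivity
  -- Every endpoint divisible by `Q (j + 1)` also closes a full period of `E j`.
  have hQdvd : ∀ j, Q j ∣ Q (j + 1) := fun j =>
    mul_dvd_mul (Nat.factorial_dvd_factorial (by omega))
      (pow_dvd_pow _ (Nat.factorial_le (by omega)))
  have hEv : ∀ j ℓ, 1 ≤ ℓ → ℓ ≤ j + 1 → HasUniformBlocks (overlay (E j) v) ℓ :=
    fun j ℓ h1 h2 => hasUniformBlocks_overlay_allWords (Nat.dvd_factorial h1 h2) hv'
  have hT : ∀ j : ℕ, ∃ T, ∀ n ≥ T, ∀ ℓ ∈ Finset.Icc 1 (j + 1), ∀ x : Fin ℓ → Fin (b + 1),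
      |(Nat.count (fun k => block (overlay (E j) v) ℓ k = x) n : ℝ) -
        n * (1 / (Fintype.card (Fin (b + 1)) : ℝ) ^ ℓ)| ≤ n * (1 / (j + 1)) := by
    intro j
    rw [← eventually_atTop, Filter.eventually_all_finset]
    intro ℓ hℓ
    rw [Finset.mem_Icc] at hℓ
    exact (hEv j ℓ hℓ.1 hℓ.2).eventually_abs_sub_le (by positivity)
  choose T hT using hT
  let S := stagePoint Q T
  have hS : StrictMono S := strictMono_stagePoint hQ
  have hdens : ∀ j n, Q j ∣ n → Nat.count (fun k => E j k ≠ Fin.last b) n * (b + 1) = b * n := by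
    rintro j _ ⟨n, rfl⟩
    have h1 := count_periodic (p := fun k => E j k ≠ Fin.last b) (Q := Q j)
      (fun i => by
        have := allWords_add_period (Fin (b + 1)) (j + 1).factorial i
        rw [Fintype.card_fin] at this
        simp only [E, Q, this]) n 0
    rw [add_zero, Nat.count_zero, add_zero] at h1
    rw [h1, mul_right_comm, count_ne_last_allWords, mul_assoc]
  have hW : ∀ ℓ, 1 ≤ ℓ → HasUniformBlocks (overlay (splice S E) v) ℓ := by
    intro ℓ hℓ
    refine hasUniformBlocks_of_stages (w := fun j => overlay (E j) v) hS rfl ?_ ?_ ?_ ?_ hℓ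
    · exact fun j ℓ h1 h2 => ((Nat.dvd_factorial h1 h2).mul_right _).trans (dvd_stagePoint j)
    · exact fun j => le_of_add_le_left (lt_stagePoint_succ hQ j).le
    · exact fun j i h1 h2 => overlay_splice hS rfl (fun j => hdens j _ (dvd_stagePoint j))
        (fun j => hdens j _ ((hQdvd j).trans (dvd_stagePoint (j + 1)))) v h1 h2
    · intro j ℓ hj h1 h2 x n hn
      rw [← mul_one_div (n : ℝ)]
      refine hT j n ?_ ℓ (Finset.mem_Icc.2 ⟨h1, h2⟩) x
      obtain ⟨i, rfl⟩ := Nat.exists_eq_add_of_le' hj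
      -- Since `ℓ ≤ i + 2`, the factor `i + 2` before `T (i + 1)` in `stagePoint` forces `n` past
      -- the threshold.
      refine Nat.le_of_mul_le_mul_left ?_ (show 0 < i + 2 by omega)
      calc (i + 2) * T (i + 1) ≤ S (i + 1) :=
            (Nat.le_add_left _ _).trans (lt_stagePoint_succ hQ i).le
        _ ≤ ℓ * n := hn
        _ ≤ (i + 2) * n := Nat.mul_le_mul_right _ h2
  refine ⟨overlay (splice S E) v,
    fun ℓ hℓ => (isSimplyNormal_iff_hasUniformBlocks _ hℓ).2 (hW ℓ hℓ),
    (hW 1 le_rfl).infinite _, ?_⟩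
  have hw : {j : ℕ | overlay (splice S E) v j ≠ Fin.last b}.Infinite :=
    ((hW 1 le_rfl).infinite 0).mono fun j (hj : _ = _) => by
      rw [Set.mem_ofPred_eq, hj]
      exact (Fin.last_pos' (n := b)).ne
  exact ⟨hw, reduction_overlay _ _ hw⟩
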